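/- Let $\Delta$ be one of the ADE types $A_n$ ($n\ge 1$), $D_n$ ($n\ge 4$), $E_6$, $E_7$, $E_8$, let $n$ be its rank, let $G_\Delta<SL(2,\mathbb C)$ be a finite subgroup of type $\Delta$ (cyclic of order $n+1$ for $A_n$; binary dihedral, with image in $PSL(2,\mathbb C)$ the dihedral group of order $2(n-2)$, for $D_n$; binary tetrahedral, octahedral and icosahedral, with images $A_4$, $S_4$, $A_5$ in $PSL(2,\mathbb C)$, for $E_6,E_7,E_8$), and let $k=|G_\Delta|$. Let $\eta(\tau)=e^{2\pi i\tau/24}\prod_{m\ge1}(1-e^{2\pi i m\tau})$ and let $\eta_\Delta(\tau)=\prod_m\eta(m\tau)^{a_m}$ be the eta product $$\eta_{A_n}(\tau)=\frac{\eta^{n+1}((n+1)\tau)}{\eta(\tau)},\qquad \eta_{D_n}(\tau)=\frac{\eta^2(2\tau)\,\eta^{n+2}((4n-8)\tau)}{\eta(\tau)\,\eta(4\tau)\,\eta^2((2n-4)\tau)},\qquad \eta_{E_6}(\tau)=\frac{\eta^2(2\tau)\,\eta^{8}(24\tau)}{\eta(\tau)\,\eta^2(8\tau)\,\eta(12\tau)},$$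 $$\eta_{E_7}(\tau)=\frac{\eta^2(2\tau)\,\eta^{9}(48\tau)}{\eta(\tau)\,\eta(12\tau)\,\eta(16\tau)\,\eta(24\tau)},\qquad \eta_{E_8}(\tau)=\frac{\eta^2(2\tau)\,\eta^{10}(120\tau)}{\eta(\tau)\,\eta(24\tau)\,\eta(40\tau)\,\eta(60\tau)}.$$ For coprime integers $c,d$ with $d$ odd and $c\ne0$ let $\left(\frac cd\right)$ be the Kronecker symbol and put $$\left(\frac cd\right)^{*}=\left(\frac c{|d|}\right),\qquad \left(\frac cd\right)_{*}=\left(\frac c{|d|}\right)(-1)^{\frac14(\operatorname{sgn}c-1)(\operatorname{sgn}d-1)},$$ and moreover $\left(\frac0{\pm1}\right)^{*}=1$, $\left(\frac01\right)_{*}=1$, $\left(\frac0{-1}\right)_{*}=-1$. Write $e(z)=e^{2\pi i z}$, and for $A=\begin{pmatrix}a&b\\c&d\end{pmatrix}\in\Gamma_0(k)$ put $$(\eta_\Delta)^{*}(A)=\prod_m\left(\left(\frac{d}{c/m}\right)^{*}\right)^{a_m}\ (c\text{ odd}),\qquad (\eta_\Delta)_{*}(A)=\prod_m\left(\left(\frac{c/m}{d}\right)_{*}\right)^{a_m}\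 (c\text{ even}).$$ Then $\eta_\Delta$ is holomorphic on the upper half-plane and transforms as a modular form of weight $\frac n2$ for $\Gamma_0(k)$ with exactly one multiplier system, that is, there is exactly one function $\chi_\Delta:\Gamma_0(k)\to\mathbb C^*$ with $|\chi_\Delta(A)|=1$ and $$\eta_\Delta\left(\frac{a\tau+b}{c\tau+d}\right)=\chi_\Delta(A)\,(c\tau+d)^{n/2}\,\eta_\Delta(\tau)\qquad\text{for all }A\in\Gamma_0(k),\ \operatorname{Im}\tau>0,$$ where $(c\tau+d)^{n/2}$ is the principal value taken with $-\pi\le\arg(c\tau+d)<\pi$. It is given by $$\chi_\Delta(A)=\begin{cases}(\eta_\Delta)^{*}(A)\;e\!\left(\frac1{24}\,bd\,((n+1)k-1)\right),& c\text{ odd},\\[4pt](\eta_\Delta)_{*}(A)\;e\!\left(\frac1{24}\left(bd\,((n+1)k-1)+3(d-1)n\right)\right),& c\text{ even}.\end{cases}$$ -/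

import Mathlib

open scoped MatrixGroups UpperHalfPlane Manifold

noncomputable section

namespace KleinianEta

/-- The simply laced (ADE) types of irreducible root systems. -/
inductive ADEType : Type
  | A (n : ℕ) (hn : 1 ≤ n) : ADEType
  | D (n : ℕ) (hn : 4 ≤ n) : ADEType
  | E6 : ADEType
  | E7 : ADEType
  | E8 : ADEType

/-- The rank of the root system. -/
def ADEType.rank : ADEType → ℕ
  | .A n _ => n
  | .D n _ => n
  | .E6 => 6
  | .E7 => 7
  | .E8 => 8

/-- The image of a subgroup of `SL(2, ℂ)` in `PSL(2, ℂ) = SL(2, ℂ) / {±1}`. -/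
def projectiveImage (G : Subgroup SL(2, ℂ)) :
    Subgroup (SL(2, ℂ) ⧸ Subgroup.center SL(2, ℂ)) :=
  G.map (QuotientGroup.mk' (Subgroup.center SL(2, ℂ)))

/-- `Δ.IsTypeOf G`: the finite subgroup `G` of `SL(2, ℂ)` has type `Δ` in the ADE classification
of finite subgroups of `SL(2, ℂ)`. Type `A n` is the cyclic group of order `n + 1`, type `D n` the
binary dihedral group lying over the dihedral group of order `2 (n - 2)` in `PSL(2, ℂ)`, and
types `E6`, `E7`, `E8` are the binary tetrahedral, octahedral and icosahedral groups, lying over the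
rotation groups `A₄`, `S₄`, `A₅` of the regular polyhedra. (In types `D` and `E` the image has even
order, so `G` contains `-1`, the only involution of `SL(2, ℂ)`, and is the full preimage.) -/
def ADEType.IsTypeOf (Δ : ADEType) (G : Subgroup SL(2, ℂ)) : Prop :=
  match Δ with
  | .A n _ => IsCyclic G ∧ Nat.card G = n + 1
  | .D n _ => Nonempty (projectiveImage G ≃* DihedralGroup (n - 2))
  | .E6 => Nonempty (projectiveImage G ≃* alternatingGroup (Fin 4))
  | .E7 => Nonempty (projectiveImage G ≃* Equiv.Perm (Fin 4))
  | .E8 => Nonempty (projectiveImage G ≃* alternatingGroup (Fin 5))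

/-- The eta product `∏ₘ η(m τ) ^ aₘ` with exponents `a`, where `η` is the Dedekind eta function. -/
def etaProduct (a : ℕ →₀ ℤ) (τ : ℍ) : ℂ :=
  a.prod fun m e => ModularForm.eta ((m : ℂ) * (τ : ℂ)) ^ e

open Finsupp in
/-- The exponents `aₘ` of the eta product `η_Δ`. -/
def ADEType.exponents : ADEType → (ℕ →₀ ℤ)
  | .A n _ => single (n + 1) ((n : ℤ) + 1) - single 1 1
  | .D n _ => single 2 2 + single (4 * n - 8) ((n : ℤ) + 2)
      - single 1 1 - single 4 1 - single (2 * n - 4) 2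
  | .E6 => single 2 2 + single 24 8 - single 1 1 - single 8 2 - single 12 1
  | .E7 => single 2 2 + single 48 9 - single 1 1 - single 12 1 - single 16 1 - single 24 1
  | .E8 => single 2 2 + single 120 10 - single 1 1 - single 24 1 - single 40 1 - single 60 1

/-- The eta product `η_Δ` attached to the type `Δ`. -/
def ADEType.eta (Δ : ADEType) : ℍ → ℂ := etaProduct Δ.exponents

/-- The symbol `(c / d)^* = (c / |d|)` for coprime `c`, `d` with `d` odd. (For `c = 0` and `d = ±1`
it is `1`.) As `|d|` is odd and positive, the Kronecker symbol is the Jacobi symbol. -/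
def upperSymbol (c d : ℤ) : ℤ := jacobiSym c d.natAbs

/-- The symbol `(c / d)_*` for coprime `c`, `d` with `d` odd: it is
`(c / |d|) (-1) ^ ((sgn c - 1) (sgn d - 1) / 4)` for `c ≠ 0`, while
`(0 / 1)_* = 1` and `(0 / -1)_* = -1`. -/
def lowerSymbol (c d : ℤ) : ℤ :=
  if c = 0 then d.sign
  else jacobiSym c d.natAbs * (-1) ^ ((c.sign - 1) * (d.sign - 1) / 4).toNat

/-- `(f)^*(A) = ∏ₘ ((d / (c/m))^*) ^ aₘ`, for `f` the eta product with exponents `a`. -/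
def upperFactor (a : ℕ →₀ ℤ) (A : SL(2, ℤ)) : ℂ :=
  a.prod fun m e => (upperSymbol (A 1 1) (A 1 0 / (m : ℤ)) : ℂ) ^ e

/-- `(f)_*(A) = ∏ₘ (((c/m) / d)_*) ^ aₘ`, for `f` the eta product with exponents `a`. -/
def lowerFactor (a : ℕ →₀ ℤ) (A : SL(2, ℤ)) : ℂ :=
  a.prod fun m e => (lowerSymbol (A 1 0 / (m : ℤ)) (A 1 1) : ℂ) ^ e

/-- `e(z) = exp(2 π i z)`. -/
def e (z : ℂ) : ℂ := Complex.exp (2 * Real.pi * Complex.I * z)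

/-- The argument of `z ≠ 0`, normalized by `-π ≤ arg z < π`. -/
def argIco (z : ℂ) : ℝ := if z.arg = Real.pi then -Real.pi else z.arg

/-- The principal value of `z ^ r` for `z ≠ 0`, with the argument normalized by
`-π ≤ arg z < π`. -/
def principalPow (z : ℂ) (r : ℝ) : ℂ :=
  Complex.exp ((r : ℂ) * ((Real.log ‖z‖ : ℂ) + (argIco z : ℂ) * Complex.I))

/-- The holomorphic function `f` on the upper half-plane transforms as a modular form of weight `r`
with the multiplier system `χ` for the group `Γ`. -/
structure TransformsWith (Γ : Subgroup SL(2, ℤ)) (r : ℝ) (χ : Γ → ℂ) (f : ℍ → ℂ) : Prop where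
  holomorphic : MDifferentiable 𝓘(ℂ) 𝓘(ℂ) f
  norm_eq_one : ∀ A : Γ, ‖χ A‖ = 1
  transform : ∀ (A : Γ) (τ : ℍ),
    f ((A : SL(2, ℤ)) • τ) =
      χ A * principalPow (((A : SL(2, ℤ)) 1 0 : ℂ) * (τ : ℂ) + ((A : SL(2, ℤ)) 1 1 : ℂ)) r * f τ

end KleinianEta

end

/-! ### Roots of unity and the branch of the square root. -/

namespace KleinianEta

open Complex

/-! Everything rests on the explicit multiplier of Dedekind's η on all of SL(2, ℤ) (`etaFormula`).
The formula at `A` is shown to be equivalent to the formula at `A * S` and at `A * T`; since `S` and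
`T` generate the group, it suffices to check it at the identity. Under `S` the branch of the square
root contributes a sign, `invSign`, and this is the sign produced by the Jacobi symbols in their
sign conventions. Under `T` no sign occurs, and for odd `c` the exponents match because 24 divides
`c (c² - 1)`.

If `m ∣ c`, then `m • Aτ = A'(mτ)`, where `A'` is `A` conjugated by diag(m, 1). It has the same
factor `cτ + d`, so the multiplier of an eta product is the product of the multipliers at the `A'`
(`etaProduct_smul`). In the exponent, every term proportional to `1/m` is killed by `∑ aₘ/m = 0`;
what survives involves only `∑ m aₘ` and `∑ aₘ`. Because η has no zeros, the multiplier is unique.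

For the ADE exponents these sums are `(n + 1) k - 1` and `n`, and every `m` divides `k`. The value
of `k = |G|` follows from the projective image: in types D and E it has even order, which forces `-1
∈ G`, so `|G|` is twice that order. -/

theorem e_add (z w : ℂ) : e (z + w) = e z * e w := by
  rw [e, e, e, ← Complex.exp_add]; ring_nf

theorem e_zero : e 0 = 1 := by simp [e]

theorem e_int (k : ℤ) : e k = 1 := by
  rw [e, mul_comm]
  exact Complex.exp_int_mul_two_pi_mul_I k

theorem e_half : e (1 / 2) = -1 := by
  rw [e, ← Complex.exp_pi_mul_I]
  ring_nf

theorem e_zsmul (z : ℂ) (k : ℤ) : e (k * z) = e z ^ k := by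
  rw [e, e, ← Complex.exp_int_mul]; ring_nf

theorem e_sum {ι : Type*} (s : Finset ι) (f : ι → ℂ) : e (∑ i ∈ s, f i) = ∏ i ∈ s, e (f i) := by
  rw [e, Finset.mul_sum, Complex.exp_sum]; rfl

theorem norm_e_ofReal (x : ℝ) : ‖e x‖ = 1 := by
  have : 2 * (Real.pi : ℂ) * I * x = ((2 * Real.pi * x : ℝ) : ℂ) * I := by push_cast; ring
  rw [e, this, Complex.norm_exp_ofReal_mul_I]

/-- The 24-th root of unity `e(k / 24)`. -/
noncomputable def zeta24 (k : ℤ) : ℂ := e ((k : ℂ) / 24)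

theorem zeta24_add (j k : ℤ) : zeta24 (j + k) = zeta24 j * zeta24 k := by
  rw [zeta24, zeta24, zeta24, ← e_add]; push_cast; ring_nf

theorem zeta24_mul_24 (k : ℤ) : zeta24 (24 * k) = 1 := by
  rw [zeta24, ← e_int k]; push_cast; ring_nf

theorem zeta24_mul_12 (k : ℤ) : zeta24 (12 * k) = if Even k then 1 else -1 := by
  rw [zeta24, show ((12 * k : ℤ) : ℂ) / 24 = k * (1 / 2) by push_cast; ring, e_zsmul, e_half]
  split_ifs with h
  · exact h.neg_one_zpow
  · exact (Int.not_even_iff_odd.mp h).neg_one_zpow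

theorem zeta24_congr {j k : ℤ} (h : (24 : ℤ) ∣ j - k) : zeta24 j = zeta24 k := by
  obtain ⟨l, hl⟩ := h
  rw [show j = k + 24 * l by linarith, zeta24_add, zeta24_mul_24, mul_one]

/-- The logarithm with imaginary part in `[-π, π)`. -/
noncomputable def logIco (z : ℂ) : ℂ := (Real.log ‖z‖ : ℂ) + (argIco z : ℂ) * I

theorem principalPow_eq (z : ℂ) (r : ℝ) : principalPow z r = exp (r * logIco z) := rfl

theorem principalPow_ne_zero (z : ℂ) (r : ℝ) : principalPow z r ≠ 0 := exp_ne_zero _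

theorem principalPow_zpow (z : ℂ) (r : ℝ) (k : ℤ) :
    principalPow z r ^ k = principalPow z (k * r) := by
  rw [principalPow_eq, principalPow_eq, ← Complex.exp_int_mul]; push_cast; ring_nf

theorem argIco_mem (z : ℂ) : -Real.pi ≤ argIco z ∧ argIco z < Real.pi := by
  have := Real.pi_pos
  unfold argIco
  split_ifs with h
  · constructor <;> linarith
  · exact ⟨(neg_pi_lt_arg z).le, lt_of_le_of_ne (arg_le_pi z) h⟩

theorem argIco_of_im_pos {z : ℂ} (h : 0 < z.im) : argIco z = z.arg ∧ 0 < argIco z := by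
  have h1 : z.arg ≠ Real.pi := fun h' => by
    have := (arg_eq_pi_iff.mp h').2
    linarith
  have h2 : argIco z = z.arg := if_neg h1
  refine ⟨h2, ?_⟩
  rw [h2]
  refine lt_of_le_of_ne (arg_nonneg_iff.mpr h.le) fun h' => ?_
  have := (arg_eq_zero_iff.mp h'.symm).2
  linarith

theorem argIco_of_im_neg {z : ℂ} (h : z.im < 0) : -Real.pi < argIco z ∧ argIco z < 0 := by
  have h0 := arg_neg_iff.mpr h
  have h1 : z.arg ≠ Real.pi := fun h' => by
    have := (arg_eq_pi_iff.mp h').2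
    linarith
  rw [show argIco z = z.arg from if_neg h1]
  exact ⟨neg_pi_lt_arg z, h0⟩

theorem argIco_ofReal_pos {x : ℝ} (h : 0 < x) : argIco x = 0 := by
  have := Real.pi_pos
  rw [argIco, arg_ofReal_of_nonneg h.le, if_neg this.ne]

theorem argIco_ofReal_neg {x : ℝ} (h : x < 0) : argIco x = -Real.pi := by
  rw [argIco, arg_ofReal_of_neg h, if_pos rfl]

theorem exp_argIco (z : ℂ) : exp (argIco z * I) = exp (z.arg * I) := by
  unfold argIco
  split_ifs with h
  · rw [h]; push_cast; rw [neg_mul, Complex.exp_neg, Complex.exp_pi_mul_I]; norm_num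
  · rfl

theorem exp_logIco {z : ℂ} (h : z ≠ 0) : exp (logIco z) = z := by
  rw [logIco, exp_add, exp_argIco, ← ofReal_exp, Real.exp_log (norm_pos_iff.mpr h)]
  exact norm_mul_exp_arg_mul_I z

theorem exists_argIco_mul {z w : ℂ} (hz : z ≠ 0) (hw : w ≠ 0) :
    ∃ k : ℤ, argIco z + argIco w = argIco (z * w) + k * (2 * Real.pi) ∧
      logIco z + logIco w = logIco (z * w) + k * (2 * Real.pi * I) := by
  have h : exp (logIco z + logIco w) = exp (logIco (z * w)) := by
    rw [exp_add, exp_logIco hz, exp_logIco hw, exp_logIco (mul_ne_zero hz hw)]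
  obtain ⟨k, hk⟩ := exp_eq_exp_iff_exists_int.mp h
  refine ⟨k, ?_, hk⟩
  simpa [logIco] using congrArg im hk

theorem principalPow_half_mul {z w : ℂ} {k : ℤ}
    (h : logIco z + logIco w = logIco (z * w) + k * (2 * Real.pi * I)) :
    principalPow z (1 / 2) * principalPow w (1 / 2) =
      (-1) ^ k * principalPow (z * w) (1 / 2) := by
  rw [principalPow_eq, principalPow_eq, principalPow_eq, ← exp_add, ← mul_add, h, mul_add, exp_add,
    mul_comm]
  congr 1
  rw [← exp_pi_mul_I, ← exp_int_mul]
  push_cast; ring_nf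

theorem principalPow_half_eq_sqrt {z : ℂ} (h : 0 < z.im) : principalPow z (1 / 2) = sqrt z := by
  have h0 : z ≠ 0 := by rintro rfl; simp at h
  rw [principalPow_eq, sqrt_eq_exp h0, logIco, (argIco_of_im_pos h).1, log]
  push_cast; ring_nf

/-- The sign in the cocycle relation of the square root for `-1 / τ`. -/
def invSign (c d : ℤ) : ℤ := if 0 < c ∧ d ≤ 0 then -1 else 1

/-- Both sides are square roots of `dτ - c`, so only a sign is in question: the parity of the number
of turns by which the arguments of the two factors exceed that of the product. -/
theorem principalPow_half_inv (τ : ℍ) {c d : ℤ} (h : c ≠ 0 ∨ d ≠ 0) :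
    principalPow (c * (-1 / (τ : ℂ)) + d) (1 / 2) * principalPow τ (1 / 2) =
      invSign c d * principalPow (d * τ + (-c : ℤ)) (1 / 2) := by
  have hπ := Real.pi_pos
  have hτ : (τ : ℂ) ≠ 0 := τ.ne_zero
  have him : 0 < (τ : ℂ).im := τ.im_pos
  have hprod : (c * (-1 / (τ : ℂ)) + d) * τ = d * τ + (-c : ℤ) := by
    push_cast; field_simp; ring
  have hne : (d * τ + (-c : ℤ) : ℂ) ≠ 0 := by
    intro h0
    have hi := congrArg im h0
    have hr := congrArg re h0
    simp at hi hr
    rcases hi with hi | hi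
    · subst hi; simp at hr; omega
    · exact absurd hi τ.im_ne_zero
  have hw : (c * (-1 / (τ : ℂ)) + d) ≠ 0 := by
    intro h0; rw [h0, zero_mul] at hprod; exact hne hprod.symm
  have hinv : 0 < (-1 / (τ : ℂ)).im := by
    rw [neg_div, neg_im, one_div, inv_im, neg_div, neg_neg]
    exact div_pos him (normSq_pos.mpr hτ)
  have hwim : (c * (-1 / (τ : ℂ)) + d).im = c * (-1 / (τ : ℂ)).im := by
    simp [-neg_im]
  have hpim : (d * τ + (-c : ℤ) : ℂ).im = d * (τ : ℂ).im := by simp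
  obtain ⟨k, hk, hlog⟩ := exists_argIco_mul hw hτ
  rw [principalPow_half_mul hlog, hprod]
  rw [hprod] at hk
  have hτ1 := (argIco_of_im_pos him).2
  have hτ2 := (argIco_mem τ).2
  -- The imaginary parts of `c(-1/τ) + d` and `dτ - c` have the signs of `c` and `d`, which bounds
  -- the three arguments tightly enough to leave one integer. For `d = 0 < c` the choice `arg(-c) =
  -- -π` puts the case on the side `k = 1`.
  have key : k = if 0 < c ∧ d ≤ 0 then 1 else 0 := by
    have hk0 : ∀ x : ℝ, x = k * (2 * Real.pi) → -(2 * Real.pi) < x → x < 2 * Real.pi → k = 0 := by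
      intro x hx h1 h2
      have h3 : (-1 : ℝ) < k := by nlinarith
      have h4 : (k : ℝ) < 1 := by nlinarith
      have h3' : (-1 : ℤ) < k := by exact_mod_cast h3
      have h4' : k < (1 : ℤ) := by exact_mod_cast h4
      omega
    have hk1 : ∀ x : ℝ, x = k * (2 * Real.pi) → 0 < x → x < 4 * Real.pi → k = 1 := by
      intro x hx h1 h2
      have h3 : (0 : ℝ) < k := by nlinarith
      have h4 : (k : ℝ) < 2 := by nlinarith
      have h3' : (0 : ℤ) < k := by exact_mod_cast h3
      have h4' : k < (2 : ℤ) := by exact_mod_cast h4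
      omega
    have hm := argIco_mem (d * τ + (-c : ℤ) : ℂ)
    rcases lt_trichotomy c 0 with hc | hc | hc
    · rw [if_neg (by omega)]
      have hc' : (c : ℝ) < 0 := by exact_mod_cast hc
      have := argIco_of_im_neg (z := c * (-1 / (τ : ℂ)) + d) (by rw [hwim]; nlinarith)
      rcases lt_trichotomy d 0 with hd | hd | hd
      · have hd' : (d : ℝ) < 0 := by exact_mod_cast hd
        have := argIco_of_im_neg (z := d * τ + (-c : ℤ)) (by rw [hpim]; nlinarith)
        exact hk0 _ (eq_sub_of_add_eq' hk.symm).symm (by linarith) (by linarith)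
      · subst hd
        have := argIco_ofReal_pos (x := (-c : ℤ)) (by push_cast; linarith)
        rw [show ((0 : ℤ) * (τ : ℂ) + (-c : ℤ)) = (((-c : ℤ) : ℝ) : ℂ) by push_cast; ring, this]
          at hk
        exact hk0 _ (eq_sub_of_add_eq' hk.symm).symm (by linarith) (by linarith)
      · have hd' : (0 : ℝ) < d := by exact_mod_cast hd
        have := argIco_of_im_pos (z := d * τ + (-c : ℤ)) (by rw [hpim]; positivity)
        exact hk0 _ (eq_sub_of_add_eq' hk.symm).symm (by linarith) (by linarith)
    · subst hc
      rw [if_neg (by omega)]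
      rcases lt_or_gt_of_ne (show d ≠ 0 by omega) with hd | hd
      · have hd' : (d : ℝ) < 0 := by exact_mod_cast hd
        have h1 := argIco_of_im_neg (z := d * τ + (-0 : ℤ)) (by rw [hpim]; nlinarith)
        have h2 := argIco_ofReal_neg (x := d) hd'
        rw [show ((0 : ℤ) * (-1 / (τ : ℂ)) + d) = ((d : ℝ) : ℂ) by push_cast; ring, h2] at hk
        exact hk0 _ (eq_sub_of_add_eq' hk.symm).symm (by linarith) (by linarith)
      · have hd' : (0 : ℝ) < d := by exact_mod_cast hd
        have h1 := argIco_of_im_pos (z := d * τ + (-0 : ℤ)) (by rw [hpim]; positivity)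
        have h2 := argIco_ofReal_pos (x := d) hd'
        rw [show ((0 : ℤ) * (-1 / (τ : ℂ)) + d) = ((d : ℝ) : ℂ) by push_cast; ring, h2] at hk
        exact hk0 _ (eq_sub_of_add_eq' hk.symm).symm (by linarith) (by linarith)
    · have hc' : (0 : ℝ) < c := by exact_mod_cast hc
      have h3 := argIco_of_im_pos (z := c * (-1 / (τ : ℂ)) + d) (by rw [hwim]; positivity)
      have h4 := argIco_mem (c * (-1 / (τ : ℂ)) + d)
      rcases lt_trichotomy d 0 with hd | hd | hd
      · have hd' : (d : ℝ) < 0 := by exact_mod_cast hd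
        rw [if_pos ⟨hc, hd.le⟩]
        have := argIco_of_im_neg (z := d * τ + (-c : ℤ)) (by rw [hpim]; nlinarith)
        exact hk1 _ (eq_sub_of_add_eq' hk.symm).symm (by linarith) (by linarith)
      · subst hd
        rw [if_pos ⟨hc, le_rfl⟩]
        have := argIco_ofReal_neg (x := (-c : ℤ)) (by push_cast; linarith)
        rw [show ((0 : ℤ) * (τ : ℂ) + (-c : ℤ)) = (((-c : ℤ) : ℝ) : ℂ) by push_cast; ring, this]
          at hk
        exact hk1 _ (eq_sub_of_add_eq' hk.symm).symm (by linarith) (by linarith)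
      · have hd' : (0 : ℝ) < d := by exact_mod_cast hd
        rw [if_neg (by omega)]
        have := argIco_of_im_pos (z := d * τ + (-c : ℤ)) (by rw [hpim]; positivity)
        exact hk0 _ (eq_sub_of_add_eq' hk.symm).symm (by linarith) (by linarith)
  rw [key, invSign]
  split_ifs <;> simp

end KleinianEta

/-! ### Quadratic symbols and the action of `S` and `T` on the multiplier of η. -/

namespace KleinianEta

open Complex ModularForm

theorem jacobiSym_neg_natAbs (c : ℤ) {m : ℕ} (hm : Odd m) :
    jacobiSym (-c) m = (if m % 4 = 3 then -1 else 1) * jacobiSym c m := by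
  rw [jacobiSym.neg c hm, ZMod.χ₄_nat_eq_if_mod_four]
  have := Nat.odd_iff.mp hm
  congr 1
  split_ifs <;> first | rfl | omega

theorem lowerSymbol_of_ne_zero {c d : ℤ} (hc : c ≠ 0) (hd : d ≠ 0) :
    lowerSymbol c d = jacobiSym c d.natAbs * if c < 0 ∧ d < 0 then -1 else 1 := by
  rw [lowerSymbol, if_neg hc]
  congr 1
  rcases lt_or_gt_of_ne hc with h | h <;> rcases lt_or_gt_of_ne hd with h' | h' <;>
    simp [Int.sign_eq_one_of_pos, Int.sign_eq_neg_one_of_neg, h, h', h.le, h'.le, not_lt.mpr]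

/-- Quadratic reciprocity for the symbols `(c / d)_*` and `(d / c)^*`. -/
theorem lowerSymbol_eq_upperSymbol {c d : ℤ} (hc : Odd c) (hd : Odd d) :
    lowerSymbol c d = (if c % 4 = 3 ∧ d % 4 = 3 then -1 else 1) * upperSymbol d c := by
  have hc' := Int.odd_iff.mp hc
  have hd' := Int.odd_iff.mp hd
  rw [lowerSymbol_of_ne_zero (by omega) (by omega), upperSymbol]
  have hm : Odd c.natAbs := Int.natAbs_odd.mpr hc
  have hn : Odd d.natAbs := Int.natAbs_odd.mpr hd
  have hr := jacobiSym.quadratic_reciprocity_if (Nat.odd_iff.mp hm) (Nat.odd_iff.mp hn)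
  rcases Int.natAbs_eq c with h1 | h1 <;> rcases Int.natAbs_eq d with h2 | h2 <;>
    generalize c.natAbs = m at * <;> generalize d.natAbs = n at * <;> subst h1 <;> subst h2 <;>
    have hm2 := Nat.odd_iff.mp hm <;> have hn2 := Nat.odd_iff.mp hn <;>
    simp only [jacobiSym_neg_natAbs _ hm, jacobiSym_neg_natAbs _ hn, ← hr] <;>
    rcases (show m % 4 = 1 ∨ m % 4 = 3 by omega) with hm4 | hm4 <;>
    rcases (show n % 4 = 1 ∨ n % 4 = 3 by omega) with hn4 | hn4 <;>
    simp [hm4, hn4, show ((m : ℤ) % 4) = (m % 4 : ℕ) by omega,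
      show ((n : ℤ) % 4) = (n % 4 : ℕ) by omega, show (-(m : ℤ) % 4) = (4 - m % 4 : ℕ) by omega,
      show (-(n : ℤ) % 4) = (4 - n % 4 : ℕ) by omega, show 0 < m by omega, show 0 < n by omega]

/-- The eta multiplier for odd `c`. -/
noncomputable def etaMultOdd (a b c d : ℤ) : ℂ :=
  upperSymbol d c * zeta24 ((a + d) * c - b * d * (c ^ 2 - 1) - 3 * c)

/-- The eta multiplier for odd `d`. -/
noncomputable def etaMultEven (a b c d : ℤ) : ℂ :=
  lowerSymbol c d * zeta24 ((a + d) * c - b * d * (c ^ 2 - 1) + 3 * d - 3 - 3 * c * d)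

/-- With `c = 2x + 1` and `d = 2y + 1` the exponents differ by `-12xy`, giving the sign `(-1)^(xy)`,
which is the sign of quadratic reciprocity. -/
theorem etaMultEven_eq_etaMultOdd (a b : ℤ) {c d : ℤ} (hc : Odd c) (hd : Odd d) :
    etaMultEven a b c d = etaMultOdd a b c d := by
  rw [etaMultEven, etaMultOdd, lowerSymbol_eq_upperSymbol hc hd]
  obtain ⟨x, rfl⟩ := hc
  obtain ⟨y, rfl⟩ := hd
  rw [show (a + (2 * y + 1)) * (2 * x + 1) - b * (2 * y + 1) * ((2 * x + 1) ^ 2 - 1) +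
      3 * (2 * y + 1) - 3 - 3 * (2 * x + 1) * (2 * y + 1) =
      ((a + (2 * y + 1)) * (2 * x + 1) - b * (2 * y + 1) * ((2 * x + 1) ^ 2 - 1) -
      3 * (2 * x + 1)) + 12 * (-(x * y)) by ring, zeta24_add, zeta24_mul_12]
  have h : (Even (-(x * y))) ↔ ¬ ((2 * x + 1) % 4 = 3 ∧ (2 * y + 1) % 4 = 3) := by
    rw [even_neg, Int.even_mul, Int.even_iff, Int.even_iff]; omega
  by_cases h' : ((2 * x + 1) % 4 = 3 ∧ (2 * y + 1) % 4 = 3)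
  · rw [if_pos h', if_neg (fun h'' => h.mp h'' h')]; push_cast; ring
  · rw [if_neg h', if_pos (h.mpr h')]; push_cast; ring

/-- The correction when both entries are negative is the branch sign for `d ≠ 0`; for `d = 0` the
convention `(0/±1)_* = ±1` supplies it. -/
theorem lowerSymbol_neg_right_eq {c d : ℤ} (hc : Odd c) (h : IsCoprime c d) :
    lowerSymbol d (-c) = invSign c d * upperSymbol d c := by
  have hc' := Int.odd_iff.mp hc
  rw [invSign, upperSymbol]
  by_cases hd : d = 0
  · subst hd
    rw [isCoprime_zero_right, Int.isUnit_iff] at h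
    rcases h with rfl | rfl <;> simp [lowerSymbol]
  · rw [lowerSymbol_of_ne_zero hd (by omega), Int.natAbs_neg, mul_comm]
    congr 1
    by_cases h1 : 0 < c ∧ d ≤ 0
    · rw [if_pos h1, if_pos (by omega)]
    · rw [if_neg h1, if_neg (by omega)]

theorem etaMultEven_mul_S {a b c d : ℤ} (h : a * d - b * c = 1) (hc : Odd c) :
    etaMultOdd a b c d * zeta24 (-3) * invSign c d = etaMultEven b (-a) d (-c) := by
  rw [etaMultOdd, etaMultEven,
    lowerSymbol_neg_right_eq hc ⟨-b, a, by linarith⟩]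
  rw [show (b + -c) * d - -a * -c * (d ^ 2 - 1) + 3 * -c - 3 - 3 * d * -c =
    ((a + d) * c - b * d * (c ^ 2 - 1) - 3 * c) + (-3) by
      linear_combination (-d * c) * h, zeta24_add]
  push_cast; ring

/-- The first supplement gives `(-1/|d|)`; passing from `|d|` to `d` costs a sign when `d < 0`,
absorbed by `invSign` and the sign correction in `lowerSymbol`. -/
theorem upperSymbol_neg_left_eq {c d : ℤ} (hd : Odd d) (h : IsCoprime c d) :
    (upperSymbol (-c) d : ℤ) =
      invSign c d * lowerSymbol c d * if Even ((1 - d) / 2) then 1 else -1 := by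
  have hd' := Int.odd_iff.mp hd
  by_cases hc : c = 0
  · subst hc
    rw [isCoprime_zero_left, Int.isUnit_iff] at h
    rcases h with rfl | rfl <;> simp [lowerSymbol, upperSymbol, invSign]
  · rw [lowerSymbol_of_ne_zero hc (by omega), upperSymbol, invSign,
      jacobiSym_neg_natAbs _ (Int.natAbs_odd.mpr hd)]
    generalize jacobiSym c d.natAbs = J
    have h1 : (Even ((1 - d) / 2)) ↔ d % 4 = 1 := by rw [Int.even_iff]; omega
    simp only [h1]
    split_ifs <;> omega

theorem etaMultOdd_mul_S {a b c d : ℤ} (h : a * d - b * c = 1) (hd : Odd d) :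
    etaMultEven a b c d * zeta24 (-3) * invSign c d = etaMultOdd b (-a) d (-c) := by
  rw [etaMultOdd, etaMultEven,
    upperSymbol_neg_left_eq hd ⟨-b, a, by linarith⟩]
  obtain ⟨y, rfl⟩ := hd
  rw [show (b + -c) * (2 * y + 1) - -a * -c * ((2 * y + 1) ^ 2 - 1) - 3 * (2 * y + 1) =
    ((a + (2 * y + 1)) * c - b * (2 * y + 1) * (c ^ 2 - 1) + 3 * (2 * y + 1) - 3 -
      3 * c * (2 * y + 1)) + (-3) + 12 * (-y) by
      linear_combination (-(2 * y + 1) * c) * h, zeta24_add, zeta24_add _ (-3), zeta24_mul_12,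
      show (1 - (2 * y + 1)) / 2 = -y by omega]
  split_ifs <;> push_cast <;> ring

theorem etaMultOdd_mul_T {a b c d : ℤ} (h : a * d - b * c = 1) (hc : Odd c) :
    etaMultOdd a b c d * zeta24 1 = etaMultOdd a (a + b) c (c + d) := by
  have hs : upperSymbol (c + d) c = upperSymbol d c := by
    rw [upperSymbol, upperSymbol]
    apply jacobiSym.mod_left'
    rw [Int.add_emod, Int.emod_eq_zero_of_dvd (Int.natAbs_dvd.mpr dvd_rfl), zero_add,
      Int.emod_emod]
  rw [etaMultOdd, etaMultOdd, hs, mul_assoc, ← zeta24_add]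
  congr 1
  apply zeta24_congr
  -- By the determinant relation the two exponents differ by `c (c² - 1)(a + 2b)`. Three consecutive
  -- integers give the factor 3, and the square of an odd integer is 1 modulo 8.
  have h24 : (24 : ℤ) ∣ (c ^ 2 - 1) * c := by
    obtain ⟨x, rfl⟩ := hc
    have h3 : (3 : ℤ) ∣ ((2 * x + 1) ^ 2 - 1) * (2 * x + 1) := by
      rw [show ((2 * x + 1) ^ 2 - 1) * (2 * x + 1) = 4 * (x * (x + 1) * (2 * x + 1)) by ring]
      apply Dvd.dvd.mul_left
      rcases (show x % 3 = 0 ∨ x % 3 = 1 ∨ x % 3 = 2 by omega) with h | h | h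
      · exact ((Int.dvd_of_emod_eq_zero h).mul_right _).mul_right _
      · exact Dvd.dvd.mul_left (by omega) _
      · exact (Dvd.dvd.mul_left (by omega) _).mul_right _
    have h8 : (8 : ℤ) ∣ ((2 * x + 1) ^ 2 - 1) * (2 * x + 1) := by
      obtain ⟨y, hy⟩ := Int.even_mul_succ_self x
      exact ⟨y * (2 * x + 1), by linear_combination 4 * (2 * x + 1) * hy⟩
    omega
  refine (h24.mul_right (a + 2 * b)).trans (dvd_of_eq ?_)
  linear_combination -(c ^ 2 - 1) * h

/-! ### The transformation of η under SL(2, ℤ). -/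

theorem mul_S_zero (A : SL(2, ℤ)) (i : Fin 2) : (A * ModularGroup.S) i 0 = A i 1 := by
  simp [Matrix.mul_apply, ModularGroup.coe_S]

theorem mul_S_one (A : SL(2, ℤ)) (i : Fin 2) : (A * ModularGroup.S) i 1 = -A i 0 := by
  simp [Matrix.mul_apply, ModularGroup.coe_S]

theorem mul_T_zero (A : SL(2, ℤ)) (i : Fin 2) : (A * ModularGroup.T) i 0 = A i 0 := by
  simp [Matrix.mul_apply, ModularGroup.coe_T]

theorem mul_T_one (A : SL(2, ℤ)) (i : Fin 2) : (A * ModularGroup.T) i 1 = A i 0 + A i 1 := by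
  simp [Matrix.mul_apply, ModularGroup.coe_T]

theorem mul_T_inv_zero (A : SL(2, ℤ)) (i : Fin 2) : (A * ModularGroup.T⁻¹) i 0 = A i 0 := by
  rw [← mul_T_zero, inv_mul_cancel_right]

theorem mul_T_inv_one (A : SL(2, ℤ)) (i : Fin 2) :
    (A * ModularGroup.T⁻¹) i 1 = A i 1 - A i 0 := by
  have := mul_T_one (A * ModularGroup.T⁻¹) i
  rw [inv_mul_cancel_right, mul_T_inv_zero] at this
  linarith

/-- The transformation of the Dedekind eta function under `A` with multiplier `v`. -/
def EtaTransforms (A : SL(2, ℤ)) (v : ℂ) : Prop :=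
  ∀ τ : ℍ, ModularForm.eta ((A • τ : ℍ) : ℂ) = v * principalPow ((A 1 0 : ℂ) * τ + (A 1 1 : ℂ)) (1 / 2) * ModularForm.eta τ

theorem eta_add_one (z : ℂ) : ModularForm.eta (z + 1) = zeta24 1 * ModularForm.eta z := by
  have h : Function.Periodic.qParam 1 (z + 1) = Function.Periodic.qParam 1 z := by
    simp [Function.Periodic.qParam, mul_add, Complex.exp_add]
  simp only [ModularForm.eta, eta_q, h, ← mul_assoc]
  congr 1
  rw [Function.Periodic.qParam, Function.Periodic.qParam, zeta24, e, ← Complex.exp_add]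
  congr 1
  push_cast; ring

theorem eta_S (τ : ℍ) :
    ModularForm.eta (-1 / (τ : ℂ)) = zeta24 (-3) * principalPow τ (1 / 2) * ModularForm.eta τ := by
  have h := eta_comp_eq_csqrt_I_inv τ.2
  simp only [Function.comp_apply, Pi.smul_apply, Pi.mul_apply, smul_eq_mul] at h
  rw [h, principalPow_half_eq_sqrt τ.2, sqrt_eq_exp I_ne_zero, log_I, zeta24, e, ← mul_assoc,
    ← Complex.exp_neg]
  congr 3
  push_cast; ring

theorem EtaTransforms.mul_S {A : SL(2, ℤ)} {v : ℂ} (h : EtaTransforms A v) :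
    EtaTransforms (A * ModularGroup.S) (v * zeta24 (-3) * invSign (A 1 0) (A 1 1)) := by
  intro τ
  have hcd : A 1 0 ≠ 0 ∨ A 1 1 ≠ 0 := by
    by_contra! h'
    have := A.det_coe
    rw [Matrix.det_fin_two, h'.1, h'.2] at this
    simp at this
  have hS : ((ModularGroup.S • τ : ℍ) : ℂ) = -1 / (τ : ℂ) := by
    rw [UpperHalfPlane.modular_S_smul]; simp [neg_div]
  have h1 := principalPow_half_inv τ hcd
  have h2 : (A * ModularGroup.S) 1 0 = A 1 1 := mul_S_zero A 1
  have h3 : (A * ModularGroup.S) 1 1 = - A 1 0 := mul_S_one A 1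
  rw [mul_smul, h, hS, eta_S, h2, h3]
  linear_combination v * zeta24 (-3) * ModularForm.eta τ * h1

theorem EtaTransforms.mul_T_iff {A : SL(2, ℤ)} {v : ℂ} :
    EtaTransforms (A * ModularGroup.T) (v * zeta24 1) ↔ EtaTransforms A v := by
  have h2 : (A * ModularGroup.T) 1 0 = A 1 0 := mul_T_zero A 1
  have h3 : (A * ModularGroup.T) 1 1 = A 1 0 + A 1 1 := mul_T_one A 1
  have hT : ∀ τ : ℍ, ((ModularGroup.T • τ : ℍ) : ℂ) = (τ : ℂ) + 1 := by
    intro τ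
    rw [UpperHalfPlane.modular_T_smul]; simp [add_comm]
  have key : ∀ τ : ℍ, (ModularForm.eta (((A * ModularGroup.T) • τ : ℍ) : ℂ) = v * zeta24 1 *
      principalPow (((A * ModularGroup.T) 1 0 : ℂ) * τ + ((A * ModularGroup.T) 1 1 : ℂ)) (1 / 2)
      * ModularForm.eta τ) ↔ ModularForm.eta ((A • (ModularGroup.T • τ) : ℍ) : ℂ) = v *
      principalPow ((A 1 0 : ℂ) * (ModularGroup.T • τ : ℍ) + (A 1 1 : ℂ)) (1 / 2) *
        ModularForm.eta (ModularGroup.T • τ : ℍ) := by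
    intro τ
    rw [mul_smul, h2, h3, hT, eta_add_one]
    have : ((A 1 0 : ℂ) * (τ + 1) + A 1 1) = (A 1 0 : ℂ) * τ + ((A 1 0 + A 1 1 : ℤ) : ℂ) := by
      push_cast; ring
    rw [this]
    constructor <;> intro h <;> rw [h] <;> ring
  constructor
  · intro h τ
    have := (key (ModularGroup.T⁻¹ • τ)).mp (h _)
    rwa [smul_inv_smul] at this
  · intro h τ
    exact (key τ).mpr (h _)

/-- The multiplier formula for the Dedekind eta function at `A`. -/
def EtaFormula (A : SL(2, ℤ)) : Prop :=
  (Odd (A 1 0) → EtaTransforms A (etaMultOdd (A 0 0) (A 0 1) (A 1 0) (A 1 1))) ∧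
  (Odd (A 1 1) → EtaTransforms A (etaMultEven (A 0 0) (A 0 1) (A 1 0) (A 1 1)))

theorem det_eq_one (A : SL(2, ℤ)) : A 0 0 * A 1 1 - A 0 1 * A 1 0 = 1 := by
  rw [← Matrix.det_fin_two, A.det_coe]

theorem etaFormula_of_odd_left {A : SL(2, ℤ)} (hc : Odd (A 1 0))
    (h : EtaTransforms A (etaMultOdd (A 0 0) (A 0 1) (A 1 0) (A 1 1))) : EtaFormula A :=
  ⟨fun _ => h, fun hd => by rwa [etaMultEven_eq_etaMultOdd _ _ hc hd]⟩

theorem etaFormula_of_odd_right {A : SL(2, ℤ)} (hd : Odd (A 1 1))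
    (h : EtaTransforms A (etaMultEven (A 0 0) (A 0 1) (A 1 0) (A 1 1))) : EtaFormula A :=
  ⟨fun hc => by rwa [← etaMultEven_eq_etaMultOdd _ _ hc hd], fun _ => h⟩

theorem odd_or_odd (A : SL(2, ℤ)) : Odd (A 1 0) ∨ Odd (A 1 1) := by
  by_contra! h
  simp only [Int.not_odd_iff_even] at h
  have h1 : Even (A 0 0 * A 1 1 - A 0 1 * A 1 0) := (h.2.mul_left _).sub (h.1.mul_left _)
  rw [det_eq_one] at h1
  exact absurd h1 (by decide)

theorem EtaFormula.mul_S {A : SL(2, ℤ)} (h : EtaFormula A) : EtaFormula (A * ModularGroup.S) := by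
  have e1 : (A * ModularGroup.S) 0 0 = A 0 1 := mul_S_zero A 0
  have e2 : (A * ModularGroup.S) 0 1 = -A 0 0 := mul_S_one A 0
  have e3 : (A * ModularGroup.S) 1 0 = A 1 1 := mul_S_zero A 1
  have e4 : (A * ModularGroup.S) 1 1 = -A 1 0 := mul_S_one A 1
  constructor
  · intro ho
    rw [e3] at ho
    rw [e1, e2, e3, e4, ← etaMultOdd_mul_S (det_eq_one A) ho]
    exact (h.2 ho).mul_S
  · intro ho
    rw [e4, odd_neg] at ho
    rw [e1, e2, e3, e4, ← etaMultEven_mul_S (det_eq_one A) ho]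
    exact (h.1 ho).mul_S

theorem etaFormula_mul_S_iff {A : SL(2, ℤ)} : EtaFormula (A * ModularGroup.S) ↔ EtaFormula A := by
  refine ⟨fun h => ?_, EtaFormula.mul_S⟩
  have h4 : A * ModularGroup.S * ModularGroup.S * ModularGroup.S * ModularGroup.S = A := by
    have : ModularGroup.S * ModularGroup.S * ModularGroup.S * ModularGroup.S = 1 := by decide
    simp only [mul_assoc] at this ⊢
    rw [this, mul_one]
  rw [← h4]
  exact h.mul_S.mul_S.mul_S

theorem etaFormula_mul_T_iff_of_odd {A : SL(2, ℤ)} (hc : Odd (A 1 0)) :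
    EtaFormula (A * ModularGroup.T) ↔ EtaFormula A := by
  have e1 : (A * ModularGroup.T) 0 0 = A 0 0 := mul_T_zero A 0
  have e2 : (A * ModularGroup.T) 0 1 = A 0 0 + A 0 1 := mul_T_one A 0
  have e3 : (A * ModularGroup.T) 1 0 = A 1 0 := mul_T_zero A 1
  have e4 : (A * ModularGroup.T) 1 1 = A 1 0 + A 1 1 := mul_T_one A 1
  have key : EtaTransforms (A * ModularGroup.T) (etaMultOdd ((A * ModularGroup.T) 0 0)
      ((A * ModularGroup.T) 0 1) ((A * ModularGroup.T) 1 0) ((A * ModularGroup.T) 1 1)) ↔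
      EtaTransforms A (etaMultOdd (A 0 0) (A 0 1) (A 1 0) (A 1 1)) := by
    rw [e1, e2, e3, e4, ← etaMultOdd_mul_T (det_eq_one A) hc, EtaTransforms.mul_T_iff]
  exact ⟨fun h => etaFormula_of_odd_left hc (key.mp (h.1 (e3 ▸ hc))),
    fun h => etaFormula_of_odd_left (e3 ▸ hc) (key.mpr (h.1 hc))⟩

theorem etaFormula_mul_T_iff {A : SL(2, ℤ)} : EtaFormula (A * ModularGroup.T) ↔ EtaFormula A := by
  by_cases hc : Odd (A 1 0)
  · exact etaFormula_mul_T_iff_of_odd hc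
  have hd := (odd_or_odd A).resolve_left hc
  rw [Int.not_odd_iff_even] at hc
  -- For even `c` this word replaces the step by `T` with two steps by `T⁻¹` at matrices whose lower
  -- left entries, `d` and `-(c + d)`, are odd.
  have hT : ModularGroup.T = ModularGroup.S * ModularGroup.T⁻¹ * ModularGroup.S * ModularGroup.T⁻¹ *
      ModularGroup.S := by decide
  have h1 : EtaFormula (A * ModularGroup.S * ModularGroup.T⁻¹) ↔ EtaFormula A := by
    rw [← etaFormula_mul_T_iff_of_odd, inv_mul_cancel_right, etaFormula_mul_S_iff]
    simpa only [mul_T_inv_zero, mul_S_zero] using hd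
  have h2 : EtaFormula (A * ModularGroup.S * ModularGroup.T⁻¹ * ModularGroup.S * ModularGroup.T⁻¹) ↔
      EtaFormula (A * ModularGroup.S * ModularGroup.T⁻¹) := by
    rw [← etaFormula_mul_T_iff_of_odd, inv_mul_cancel_right, etaFormula_mul_S_iff]
    have := hd.add_even hc
    have h3 : (A * ModularGroup.S * ModularGroup.T⁻¹ * ModularGroup.S * ModularGroup.T⁻¹) 1 0 =
      -(A 1 1 + A 1 0) := by
      simp only [mul_T_inv_zero, mul_T_inv_one, mul_S_zero, mul_S_one]
      ring
    rw [h3, odd_neg]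
    exact this
  rw [← h1, ← h2]
  nth_rw 1 [hT]
  rw [← etaFormula_mul_S_iff (A := A * _ * _ * _ * _)]
  simp only [mul_assoc]

/-- The transformation formula of the Dedekind eta function. -/
theorem etaFormula (A : SL(2, ℤ)) : EtaFormula A := by
  -- An equivalence for every `B`, rather than an implication, makes the induction pass to inverses.
  have key : ∀ g ∈ Subgroup.closure {ModularGroup.S, ModularGroup.T},
      ∀ B, EtaFormula (B * g) ↔ EtaFormula B := by
    intro g hg
    induction hg using Subgroup.closure_induction with
    | one => simp
    | mem g hg =>
      rcases hg with rfl | hg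
      · exact fun _ => etaFormula_mul_S_iff
      · rw [Set.mem_singleton_iff] at hg
        subst hg
        exact fun _ => etaFormula_mul_T_iff
    | mul x y _ _ hx hy => exact fun B => by rw [← mul_assoc, hy, hx]
    | inv x _ hx => exact fun B => by rw [← hx, inv_mul_cancel_right]
  rw [← one_mul A, key A (by simp [SpecialLinearGroup.SL2Z_generators])]
  refine etaFormula_of_odd_right (by simp) fun τ => ?_
  have h1 : logIco 1 = 0 := by
    have := argIco_ofReal_pos one_pos
    rw [ofReal_one] at this
    simp [logIco, this]
  simp [etaMultEven, lowerSymbol, principalPow_eq, h1, zeta24, e_zero]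

end KleinianEta

/-! ### Multipliers of eta products. -/

namespace KleinianEta

open Complex

/-- Conjugating `A` by `diag(m, 1)`, for `m` a divisor of the lower left entry. -/
def conjDiag (A : SL(2, ℤ)) (m : ℕ) (h : (m : ℤ) ∣ A 1 0) : SL(2, ℤ) :=
  ⟨!![A 0 0, A 0 1 * m; A 1 0 / m, A 1 1], by
    rw [Matrix.det_fin_two_of, mul_assoc, Int.mul_ediv_cancel' h, det_eq_one]⟩

/-- The conjugate acts at `mτ` with factor `(c/m)(mτ) + d = cτ + d`, so the square root is the same
for every `m` and no further branch signs arise in a product. -/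
theorem eta_mul_smul (A : SL(2, ℤ)) {m : ℕ} (hm : m ≠ 0) (h : (m : ℤ) ∣ A 1 0) {v : ℂ}
    (hv : EtaTransforms (conjDiag A m h) v) (τ : ℍ) :
    ModularForm.eta (m * ((A • τ : ℍ) : ℂ)) =
      v * principalPow ((A 1 0 : ℂ) * τ + (A 1 1 : ℂ)) (1 / 2) * ModularForm.eta (m * (τ : ℂ)) := by
  have hm0 : (0 : ℝ) < m := by exact_mod_cast Nat.pos_of_ne_zero hm
  have hmC : (m : ℂ) ≠ 0 := by exact_mod_cast hm
  let τ' : ℍ := ⟨m * (τ : ℂ), by simpa using mul_pos hm0 τ.im_pos⟩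
  have hτ' : (τ' : ℂ) = m * (τ : ℂ) := rfl
  obtain ⟨c', hc'⟩ := h
  have hdiv : A 1 0 / (m : ℤ) = c' := by
    rw [hc', Int.mul_ediv_cancel_left _ (by exact_mod_cast hm)]
  have hentries : (conjDiag A m ⟨c', hc'⟩) 0 0 = A 0 0 ∧ (conjDiag A m ⟨c', hc'⟩) 0 1 = A 0 1 * m ∧
      (conjDiag A m ⟨c', hc'⟩) 1 0 = c' ∧ (conjDiag A m ⟨c', hc'⟩) 1 1 = A 1 1 :=
    ⟨rfl, rfl, hdiv, rfl⟩
  have hcoe : ((conjDiag A m ⟨c', hc'⟩ • τ' : ℍ) : ℂ) = m * ((A • τ : ℍ) : ℂ) := by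
    rw [UpperHalfPlane.coe_specialLinearGroup_apply, UpperHalfPlane.coe_specialLinearGroup_apply]
    simp only [hentries, hτ', hc', algebraMap_int_eq, eq_intCast]
    push_cast
    ring
  have := hv τ'
  rw [hcoe, hentries.2.2.1, hentries.2.2.2, hτ', ← mul_assoc] at this
  rw [this, hc']
  push_cast
  ring_nf

theorem etaProduct_ne_zero {a : ℕ →₀ ℤ} (h0 : a 0 = 0) (τ : ℍ) : etaProduct a τ ≠ 0 := by
  refine Finset.prod_ne_zero_iff.mpr fun m hm => zpow_ne_zero _ (ModularForm.eta_ne_zero ?_)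
  have hm0 : m ≠ 0 := by rintro rfl; exact Finsupp.mem_support_iff.mp hm h0
  have : (0 : ℝ) < m := by exact_mod_cast Nat.pos_of_ne_zero hm0
  simpa using mul_pos this τ.im_pos

theorem mdifferentiable_etaProduct {a : ℕ →₀ ℤ} (h0 : a 0 = 0) :
    MDifferentiable 𝓘(ℂ) 𝓘(ℂ) (etaProduct a) := by
  rw [UpperHalfPlane.mdifferentiable_iff]
  have key : DifferentiableOn ℂ
      (fun z => ∏ m ∈ a.support, ModularForm.eta ((m : ℂ) * z) ^ a m)
      UpperHalfPlane.upperHalfPlaneSet := by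
    refine DifferentiableOn.fun_finsetProd fun m hm z hz => ?_
    have hm0 : m ≠ 0 := by rintro rfl; exact Finsupp.mem_support_iff.mp hm h0
    have hpos : (0 : ℝ) < m := by exact_mod_cast Nat.pos_of_ne_zero hm0
    have hmz : (m : ℂ) * z ∈ UpperHalfPlane.upperHalfPlaneSet := by simpa using mul_pos hpos hz
    refine DifferentiableAt.differentiableWithinAt ?_
    refine DifferentiableAt.zpow ?_ (Or.inl (ModularForm.eta_ne_zero hmz))
    exact (ModularForm.differentiableAt_eta_of_mem_upperHalfPlaneSet hmz).comp z (by fun_prop)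
  refine key.congr fun z hz => ?_
  simp only [Function.comp_apply, etaProduct, Finsupp.prod]
  rw [UpperHalfPlane.ofComplex_apply_of_im_pos hz]

/-- The multiplier of an eta product with exponents `a`, where `N = ∑ m aₘ` and `r = ∑ aₘ`. -/
noncomputable def etaProductMult (a : ℕ →₀ ℤ) (N r : ℂ) (A : SL(2, ℤ)) : ℂ :=
  if Odd (A 1 0) then upperFactor a A * e ((A 0 1 : ℂ) * (A 1 1 : ℂ) * N / 24)
  else lowerFactor a A * e (((A 0 1 : ℂ) * (A 1 1 : ℂ) * N + 3 * ((A 1 1 : ℂ) - 1) * r) / 24)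

theorem zeta24_zpow (k j : ℤ) : zeta24 k ^ j = e (j * ((k : ℂ) / 24)) := by
  rw [zeta24, e_zsmul]

theorem odd_ediv_of_dvd {c m : ℤ} (hm : m ≠ 0) (h : m ∣ c) (hc : Odd c) : Odd (c / m) := by
  obtain ⟨x, rfl⟩ := h
  rw [Int.mul_ediv_cancel_left _ hm]
  exact (Int.odd_mul.mp hc).2

theorem etaProduct_smul {a : ℕ →₀ ℤ} (h0 : a 0 = 0) {A : SL(2, ℤ)}
    (hA : ∀ m ∈ a.support, (m : ℤ) ∣ A 1 0)
    (hinv : ∑ m ∈ a.support, (a m : ℂ) / m = 0) (τ : ℍ) :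
    etaProduct a (A • τ) =
      etaProductMult a (∑ m ∈ a.support, (a m : ℂ) * m) (∑ m ∈ a.support, (a m : ℂ)) A *
      principalPow ((A 1 0 : ℂ) * τ + (A 1 1 : ℂ)) ((∑ m ∈ a.support, a m : ℤ) / 2) *
      etaProduct a τ := by
  have hne : ∀ m ∈ a.support, m ≠ 0 := by
    rintro m hm rfl; exact Finsupp.mem_support_iff.mp hm h0
  set p := principalPow ((A 1 0 : ℂ) * τ + (A 1 1 : ℂ)) (1 / 2) with hp
  have hpp : principalPow ((A 1 0 : ℂ) * τ + (A 1 1 : ℂ)) ((∑ m ∈ a.support, a m : ℤ) / 2) =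
      ∏ m ∈ a.support, p ^ a m := by
    have hsum : ∀ s : Finset ℕ, ∏ m ∈ s, p ^ a m = p ^ ∑ m ∈ s, a m := fun s => by
      induction s using Finset.induction_on with
      | empty => simp
      | insert x s hx ih =>
        rw [Finset.prod_insert hx, Finset.sum_insert hx, zpow_add₀ (principalPow_ne_zero _ _), ih]
    rw [hsum, hp, principalPow_zpow]
    ring_nf
  -- Symbol `s m` and exponent `k m` are kept arbitrary so that both parities of `c` share the
  -- argument.
  have main : ∀ s : ℕ → ℤ, ∀ k : ℕ → ℤ,
      (∀ m (hm : m ∈ a.support), EtaTransforms (conjDiag A m (hA m hm)) (s m * zeta24 (k m))) →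
      etaProduct a (A • τ) = (∏ m ∈ a.support, (s m : ℂ) ^ a m) *
        e (∑ m ∈ a.support, (a m : ℂ) * ((k m : ℂ) / 24)) *
        (∏ m ∈ a.support, p ^ a m) * etaProduct a τ := by
    intro s k h
    rw [e_sum, etaProduct, etaProduct, Finsupp.prod, Finsupp.prod, ← Finset.prod_mul_distrib,
      ← Finset.prod_mul_distrib, ← Finset.prod_mul_distrib]
    refine Finset.prod_congr rfl fun m hm => ?_
    rw [eta_mul_smul A (hne m hm) (hA m hm) (h m hm) τ, ← hp, mul_zpow, mul_zpow, mul_zpow,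
      zeta24_zpow]
  have hdiv : ∀ m ∈ a.support, ((A 1 0 / (m : ℤ) : ℤ) : ℂ) = A 1 0 / m := by
    intro m hm
    rw [Int.cast_div (hA m hm) (by exact_mod_cast hne m hm)]
    push_cast; rfl
  rw [hpp, etaProductMult]
  split_ifs with hc
  · rw [main (fun m => upperSymbol (A 1 1) (A 1 0 / (m : ℤ)))
      (fun m => (A 0 0 + A 1 1) * (A 1 0 / (m : ℤ)) -
        (A 0 1 * m) * A 1 1 * ((A 1 0 / (m : ℤ)) ^ 2 - 1) - 3 * (A 1 0 / (m : ℤ)))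
      fun m hm => (etaFormula (conjDiag A m (hA m hm))).1
        (odd_ediv_of_dvd (by exact_mod_cast hne m hm) (hA m hm) hc)]
    rw [upperFactor, Finsupp.prod]
    congr 4
    -- The exponent at `m` is `((a + d - 3)c - bdc²)/m + bdm`; this is the total of its `1/m` parts.
    have hz : (((A 0 0 + A 1 1 - 3 : ℂ) * A 1 0 - A 0 1 * A 1 1 * A 1 0 ^ 2) / 24) *
        ∑ m ∈ a.support, (a m : ℂ) / m = 0 := by rw [hinv, mul_zero]
    rw [Finset.mul_sum] at hz
    rw [Finset.mul_sum, Finset.sum_div, ← sub_eq_zero, ← Finset.sum_sub_distrib]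
    refine Eq.trans ?_ hz
    refine Finset.sum_congr rfl fun m hm => ?_
    have hmC : (m : ℂ) ≠ 0 := by exact_mod_cast hne m hm
    push_cast [hdiv m hm]
    field_simp
    ring
  · have hd := (odd_or_odd A).resolve_left hc
    rw [main (fun m => lowerSymbol (A 1 0 / (m : ℤ)) (A 1 1))
      (fun m => (A 0 0 + A 1 1) * (A 1 0 / (m : ℤ)) -
        (A 0 1 * m) * A 1 1 * ((A 1 0 / (m : ℤ)) ^ 2 - 1) + 3 * A 1 1 - 3 -
          3 * (A 1 0 / (m : ℤ)) * A 1 1)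
      fun m hm => (etaFormula (conjDiag A m (hA m hm))).2 hd]
    rw [lowerFactor, Finsupp.prod]
    congr 4
    have hz : (((A 0 0 + A 1 1 - 3 * A 1 1 : ℂ) * A 1 0 - A 0 1 * A 1 1 * A 1 0 ^ 2) / 24) *
        ∑ m ∈ a.support, (a m : ℂ) / m = 0 := by rw [hinv, mul_zero]
    rw [Finset.mul_sum] at hz
    rw [Finset.mul_sum, Finset.mul_sum, ← Finset.sum_add_distrib, Finset.sum_div, ← sub_eq_zero,
      ← Finset.sum_sub_distrib]
    refine Eq.trans ?_ hz
    refine Finset.sum_congr rfl fun m hm => ?_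
    have hmC : (m : ℂ) ≠ 0 := by exact_mod_cast hne m hm
    push_cast [hdiv m hm]
    field_simp
    ring

theorem norm_upperSymbol {c d : ℤ} (h : IsCoprime c d) : ‖((upperSymbol c d : ℤ) : ℂ)‖ = 1 := by
  have hg : c.gcd d.natAbs = 1 := by
    rw [← Int.isCoprime_iff_gcd_eq_one]
    rcases Int.natAbs_eq d with h' | h'
    · rwa [← h']
    · rw [h'] at h; exact (IsCoprime.neg_right_iff _ _).mp h
  rcases jacobiSym.eq_one_or_neg_one hg with h' | h' <;> simp [upperSymbol, h']

theorem norm_lowerSymbol {c d : ℤ} (h : IsCoprime c d) : ‖((lowerSymbol c d : ℤ) : ℂ)‖ = 1 := by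
  rw [lowerSymbol]
  split_ifs with hc
  · subst hc
    rw [isCoprime_zero_left, Int.isUnit_iff] at h
    rcases h with rfl | rfl <;> simp
  · have := norm_upperSymbol h
    rw [upperSymbol] at this
    push_cast
    rw [norm_mul, this, norm_pow, norm_neg, norm_one, one_pow, one_mul]

theorem isCoprime_ediv {A : SL(2, ℤ)} {m : ℤ} (h : m ∣ A 1 0) :
    IsCoprime (A 1 0 / m) (A 1 1) := by
  have h1 : IsCoprime (A 1 0) (A 1 1) := ⟨-A 0 1, A 0 0, by linarith [det_eq_one A]⟩
  exact h1.of_isCoprime_of_dvd_left (Int.ediv_dvd_of_dvd h)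

theorem norm_etaProductMult {a : ℕ →₀ ℤ} {A : SL(2, ℤ)}
    (hA : ∀ m ∈ a.support, (m : ℤ) ∣ A 1 0) (N r : ℝ) : ‖etaProductMult a N r A‖ = 1 := by
  rw [etaProductMult]
  split_ifs
  · rw [norm_mul, upperFactor, Finsupp.prod, norm_prod, Finset.prod_eq_one, one_mul]
    · rw [← norm_e_ofReal ((A 0 1 : ℝ) * (A 1 1 : ℝ) * N / 24)]; push_cast; rfl
    · intro m hm
      rw [norm_zpow, norm_upperSymbol (isCoprime_ediv (hA m hm)).symm, one_zpow]
  · rw [norm_mul, lowerFactor, Finsupp.prod, norm_prod, Finset.prod_eq_one, one_mul]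
    · rw [← norm_e_ofReal (((A 0 1 : ℝ) * (A 1 1 : ℝ) * N + 3 * ((A 1 1 : ℝ) - 1) * r) / 24)]
      push_cast; rfl
    · intro m hm
      rw [norm_zpow, norm_lowerSymbol (isCoprime_ediv (hA m hm)), one_zpow]

theorem transformsWith_etaProduct_iff {a : ℕ →₀ ℤ} {k : ℕ} (h0 : a 0 = 0)
    (hk : ∀ m ∈ a.support, m ∣ k) (hinv : ∑ m ∈ a.support, (a m : ℂ) / m = 0) {N r : ℤ}
    (hN : ∑ m ∈ a.support, (a m : ℂ) * m = N) (hr : ∑ m ∈ a.support, a m = r)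
    (χ : CongruenceSubgroup.Gamma0 k → ℂ) :
    TransformsWith (CongruenceSubgroup.Gamma0 k) ((r : ℝ) / 2) χ (etaProduct a) ↔
      ∀ A : CongruenceSubgroup.Gamma0 k, χ A = etaProductMult a N r A := by
  have hdvd : ∀ A : CongruenceSubgroup.Gamma0 k, ∀ m ∈ a.support,
      (m : ℤ) ∣ (A : SL(2, ℤ)) 1 0 := by
    intro A m hm
    have h1 := CongruenceSubgroup.Gamma0_mem.mp A.2
    rw [ZMod.intCast_zmod_eq_zero_iff_dvd] at h1
    exact (Int.natCast_dvd_natCast.mpr (hk m hm)).trans h1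
  have hr' : ∑ m ∈ a.support, (a m : ℂ) = r := by rw [← hr]; push_cast; rfl
  have hsmul : ∀ (A : CongruenceSubgroup.Gamma0 k) (τ : ℍ), etaProduct a ((A : SL(2, ℤ)) • τ) =
      etaProductMult a N r A * principalPow (((A : SL(2, ℤ)) 1 0 : ℂ) * τ +
        ((A : SL(2, ℤ)) 1 1 : ℂ)) ((r : ℝ) / 2) * etaProduct a τ := by
    intro A τ
    rw [etaProduct_smul h0 (hdvd A) hinv τ, hN, hr', hr]
  constructor
  · intro h A
    -- Any single point determines `χ A`, since neither the automorphy factor nor the eta product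
    -- vanishes.
    have h1 := h.transform A UpperHalfPlane.I
    rw [hsmul] at h1
    exact (mul_right_cancel₀ (principalPow_ne_zero _ _)
      (mul_right_cancel₀ (etaProduct_ne_zero h0 _) h1)).symm
  · intro h
    refine ⟨mdifferentiable_etaProduct h0, fun A => ?_, fun A τ => ?_⟩
    · rw [h]
      exact_mod_cast norm_etaProductMult (hdvd A) (N : ℝ) (r : ℝ)
    · rw [h, hsmul]

end KleinianEta

/-! ### Orders of the finite subgroups. -/

namespace KleinianEta

open Complex

/-- By Cayley–Hamilton, `g² = 1` and determinant 1 give `tr(g) g = 2`, so the trace is nonzero and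
`g` is scalar. -/
theorem sq_eq_one_imp_mem_center {g : SL(2, ℂ)} (h : g * g = 1) :
    g ∈ Subgroup.center SL(2, ℂ) := by
  have hd : g 0 0 * g 1 1 - g 0 1 * g 1 0 = 1 := by rw [← Matrix.det_fin_two, g.det_coe]
  have hm : (g : Matrix (Fin 2) (Fin 2) ℂ) * g = 1 := by
    rw [← Matrix.SpecialLinearGroup.coe_mul, h, Matrix.SpecialLinearGroup.coe_one]
  have h00 := congrFun (congrFun hm 0) 0
  have h01 := congrFun (congrFun hm 0) 1
  have h10 := congrFun (congrFun hm 1) 0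
  have h11 := congrFun (congrFun hm 1) 1
  simp only [Matrix.mul_apply, Fin.sum_univ_two, Matrix.one_apply_eq, ne_eq, zero_ne_one,
    not_false_eq_true, one_ne_zero, Matrix.one_apply_ne] at h00 h01 h10 h11
  have ht : g 0 0 + g 1 1 ≠ 0 := by
    intro ht
    have : g 0 0 * (g 0 0 + g 1 1) = 2 := by linear_combination hd + h00
    rw [ht, mul_zero] at this
    norm_num at this
  have hb : g 0 1 = 0 := by
    refine (mul_eq_zero.mp (?_ : g 0 1 * (g 0 0 + g 1 1) = 0)).resolve_right ht
    linear_combination h01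
  have hc : g 1 0 = 0 := by
    refine (mul_eq_zero.mp (?_ : g 1 0 * (g 0 0 + g 1 1) = 0)).resolve_right ht
    linear_combination h10
  have had : g 0 0 = g 1 1 := by
    refine sub_eq_zero.mp ((mul_eq_zero.mp
      (?_ : (g 0 0 - g 1 1) * (g 0 0 + g 1 1) = 0)).resolve_right ht)
    linear_combination h00 - h11
  rw [Matrix.SpecialLinearGroup.mem_center_iff]
  refine ⟨g 0 0, ?_, ?_⟩
  · rw [Fintype.card_fin]
    linear_combination hd + g 0 0 * had + g 0 1 * hc
  · ext i j
    fin_cases i <;> fin_cases j <;> simp [hb, hc, had]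

theorem card_center_SL2 : Nat.card (Subgroup.center SL(2, ℂ)) = 2 := by
  rw [Nat.card_congr (Matrix.SpecialLinearGroup.center_equiv_rootsOfUnity'
    (R := ℂ) (0 : Fin 2)).toEquiv]
  exact Complex.card_rootsOfUnity 2

/-- Cauchy gives an element of order 2 in the image. A lift `g` has `g²` central, and `g² ≠ 1`
because `g` is not central; so `g²` generates the center, which has order 2. -/
theorem center_le_of_even_card (G : Subgroup SL(2, ℂ)) [Finite G]
    (h : Even (Nat.card (projectiveImage G))) : Subgroup.center SL(2, ℂ) ≤ G := by
  have : Finite (projectiveImage G) := (Set.toFinite (G : Set SL(2, ℂ))).image _ |>.to_subtype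
  have : Fact (Nat.Prime 2) := ⟨Nat.prime_two⟩
  obtain ⟨⟨x, hx⟩, hx2⟩ := exists_prime_orderOf_dvd_card' 2 h.two_dvd
  obtain ⟨g, hg, rfl⟩ := hx
  rw [orderOf_eq_prime_iff] at hx2
  obtain ⟨h1, h2⟩ := hx2
  have h3 : g * g ∈ Subgroup.center SL(2, ℂ) := by
    rw [← QuotientGroup.eq_one_iff]
    simpa [sq] using congrArg Subtype.val h1
  have h4 : g * g ≠ 1 := by
    intro h5
    exact h2 (Subtype.ext ((QuotientGroup.eq_one_iff g).mpr (sq_eq_one_imp_mem_center h5)))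
  have : Fact (Nat.Prime (Nat.card (Subgroup.center SL(2, ℂ)))) := by
    rw [card_center_SL2]; exact ⟨Nat.prime_two⟩
  intro z hz
  have h6 : (⟨z, hz⟩ : Subgroup.center SL(2, ℂ)) ∈
      Subgroup.zpowers (⟨g * g, h3⟩ : Subgroup.center SL(2, ℂ)) :=
    mem_zpowers_of_prime_card rfl fun h7 => h4 (congrArg Subtype.val h7)
  obtain ⟨j, hj⟩ := h6
  have : (g * g) ^ j = z := congrArg Subtype.val hj
  rw [← this]
  exact G.zpow_mem (G.mul_mem hg hg) j

theorem card_eq_two_mul (G : Subgroup SL(2, ℂ)) [Finite G]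
    (h : Even (Nat.card (projectiveImage G))) : Nat.card G = 2 * Nat.card (projectiveImage G) := by
  have hle := center_le_of_even_card G h
  set f := (QuotientGroup.mk' (Subgroup.center SL(2, ℂ))).comp G.subtype with hf
  have hker : f.ker = (Subgroup.center SL(2, ℂ)).subgroupOf G := by
    rw [hf, ← MonoidHom.comap_ker, QuotientGroup.ker_mk']; rfl
  have hrange : f.range = projectiveImage G := by
    rw [hf, MonoidHom.range_comp, G.range_subtype]; rfl
  have h1 := f.ker.card_mul_index
  rw [Subgroup.index_ker, hker, hrange,
    Nat.card_congr (Subgroup.subgroupOfEquivOfLe hle).toEquiv, card_center_SL2] at h1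
  exact h1.symm

/-- The order of the finite subgroups of `SL(2, ℂ)` of type `Δ`. -/
def ADEType.level : ADEType → ℕ
  | .A n _ => n + 1
  | .D n _ => 4 * n - 8
  | .E6 => 24
  | .E7 => 48
  | .E8 => 120

theorem card_of_isTypeOf {Δ : ADEType} (G : Subgroup SL(2, ℂ)) [Finite G] (hG : Δ.IsTypeOf G) :
    Nat.card G = Δ.level := by
  match Δ, hG with
  | .A n _, hG => exact hG.2
  | .D n hn, ⟨f⟩ =>
    have hc := Nat.card_congr f.toEquiv
    rw [DihedralGroup.nat_card] at hc
    rw [card_eq_two_mul G (by rw [hc]; exact even_two_mul _), hc]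
    simp only [ADEType.level]
    omega
  | .E6, ⟨f⟩ =>
    have hc := Nat.card_congr f.toEquiv
    have h2 := nat_card_alternatingGroup (α := Fin 4)
    rw [Nat.card_fin] at h2
    rw [show Nat.factorial 4 / 2 = 12 by rfl] at h2
    rw [h2] at hc
    rw [card_eq_two_mul G (by rw [hc]; decide), hc, ADEType.level]
  | .E7, ⟨f⟩ =>
    have hc := Nat.card_congr f.toEquiv
    rw [Nat.card_perm, Nat.card_fin, show Nat.factorial 4 = 24 by rfl] at hc
    rw [card_eq_two_mul G (by rw [hc]; decide), hc, ADEType.level]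
  | .E8, ⟨f⟩ =>
    have hc := Nat.card_congr f.toEquiv
    have h2 := nat_card_alternatingGroup (α := Fin 5)
    rw [Nat.card_fin] at h2
    rw [show Nat.factorial 5 / 2 = 60 by rfl] at h2
    rw [h2] at hc
    rw [card_eq_two_mul G (by rw [hc]; decide), hc, ADEType.level]

/-! ### Numerical identities for the ADE exponents. -/

theorem exponents_zero (Δ : ADEType) : Δ.exponents 0 = 0 := by
  match Δ with
  | .A n _ => simp [ADEType.exponents]
  | .D n hn =>
    simp [ADEType.exponents, show 4 * n - 8 ≠ 0 by omega,
      show 2 * n - 4 ≠ 0 by omega]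
  | .E6 => simp [ADEType.exponents]
  | .E7 => simp [ADEType.exponents]
  | .E8 => simp [ADEType.exponents]

theorem dvd_level (Δ : ADEType) : ∀ m ∈ Δ.exponents.support, m ∣ Δ.level := by
  intro m hm
  by_contra hdvd
  refine Finsupp.mem_support_iff.mp hm ?_
  have key : ∀ j : ℕ, j ∣ Δ.level → j ≠ m := by rintro j hj rfl; exact hdvd hj
  match Δ with
  | .A n _ =>
    simp [ADEType.exponents, key (n + 1) dvd_rfl, key 1 (one_dvd _)]
  | .D n hn =>
    simp [ADEType.exponents, key (4 * n - 8) dvd_rfl, key 1 (one_dvd _),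
      key 2 ⟨2 * n - 4, by simp only [ADEType.level]; omega⟩,
      key 4 ⟨n - 2, by simp only [ADEType.level]; omega⟩,
      key (2 * n - 4) ⟨2, by simp only [ADEType.level]; omega⟩]
  | .E6 =>
    simp [ADEType.exponents, key 2 (by decide), key 24 (by decide),
      key 1 (by decide), key 8 (by decide), key 12 (by decide)]
  | .E7 =>
    simp [ADEType.exponents, key 2 (by decide), key 48 (by decide),
      key 1 (by decide), key 16 (by decide), key 12 (by decide), key 24 (by decide)]
  | .E8 =>
    simp [ADEType.exponents, key 2 (by decide), key 120 (by decide),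
      key 1 (by decide), key 40 (by decide), key 60 (by decide), key 24 (by decide)]

/-- A weighted sum of the exponents of `η_Δ`, evaluated at each of its factors. -/
theorem sum_exponents (Δ : ADEType) (w : ℕ → ℂ) :
    ∑ m ∈ Δ.exponents.support, (Δ.exponents m : ℂ) * w m = match Δ with
      | .A n _ => (n + 1) * w (n + 1) - w 1
      | .D n _ => 2 * w 2 + (n + 2) * w (4 * n - 8) - w 1 - w 4 - 2 * w (2 * n - 4)
      | .E6 => 2 * w 2 + 8 * w 24 - w 1 - 2 * w 8 - w 12
      | .E7 => 2 * w 2 + 9 * w 48 - w 1 - w 12 - w 16 - w 24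
      | .E8 => 2 * w 2 + 10 * w 120 - w 1 - w 24 - w 40 - w 60 := by
  -- Additivity in the exponents avoids computing the support, where indices can coincide: `2n - 4 =
  -- 4` in type D₄.
  let F : (ℕ →₀ ℤ) →+ ℂ := Finsupp.liftAddHom fun m =>
    (AddMonoidHom.mulRight (w m)).comp (Int.castAddHom ℂ)
  have hF : ∀ a : ℕ →₀ ℤ, F a = ∑ m ∈ a.support, (a m : ℂ) * w m := fun a => rfl
  have hs : ∀ (m : ℕ) (j : ℤ), F (Finsupp.single m j) = j * w m := fun m j => by simp [F]
  rw [← hF]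
  match Δ with
  | .A n _ | .D n _ | .E6 | .E7 | .E8 =>
    simp only [ADEType.exponents, map_add, map_sub, hs]
    push_cast
    ring

theorem sum_exponents_div (Δ : ADEType) :
    ∑ m ∈ Δ.exponents.support, (Δ.exponents m : ℂ) / m = 0 := by
  simp only [div_eq_mul_inv]
  rw [sum_exponents Δ fun m => (m : ℂ)⁻¹]
  match Δ with
  | .A n _ =>
    have : (n : ℂ) + 1 ≠ 0 := by exact_mod_cast n.succ_ne_zero
    push_cast
    field_simp
    ring
  | .D n hn =>
    -- Writing `n = 4 + j` removes the truncated subtractions.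
    obtain ⟨j, rfl⟩ := Nat.exists_eq_add_of_le hn
    dsimp only
    rw [show 4 * (4 + j) - 8 = 4 * (j + 2) by omega, show 2 * (4 + j) - 4 = 2 * (j + 2) by omega]
    have : (j : ℂ) + 2 ≠ 0 := by exact_mod_cast (by omega : j + 2 ≠ 0)
    push_cast
    field_simp
    ring
  | .E6 | .E7 | .E8 => norm_num

theorem sum_exponents_mul (Δ : ADEType) :
    ∑ m ∈ Δ.exponents.support, (Δ.exponents m : ℂ) * m =
      (((Δ.rank + 1) * Δ.level - 1 : ℤ) : ℂ) := by
  rw [sum_exponents Δ fun m => (m : ℂ)]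
  match Δ with
  | .A n _ =>
    simp only [ADEType.level, ADEType.rank]
    push_cast
    ring
  | .D n hn =>
    obtain ⟨j, rfl⟩ := Nat.exists_eq_add_of_le hn
    simp only [ADEType.level, ADEType.rank]
    rw [show 4 * (4 + j) - 8 = 4 * (j + 2) by omega, show 2 * (4 + j) - 4 = 2 * (j + 2) by omega]
    push_cast
    ring
  | .E6 | .E7 | .E8 => norm_num [ADEType.level, ADEType.rank]

theorem sum_exponents_eq_rank (Δ : ADEType) :
    ∑ m ∈ Δ.exponents.support, Δ.exponents m = Δ.rank := by
  have h := sum_exponents Δ fun _ => 1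
  simp only [mul_one] at h
  have : ((∑ m ∈ Δ.exponents.support, Δ.exponents m : ℤ) : ℂ) = ((Δ.rank : ℤ) : ℂ) := by
    push_cast
    rw [h]
    match Δ with
    | .A n _ | .D n _ | .E6 | .E7 | .E8 =>
      simp only [ADEType.rank]
      push_cast
      ring
  exact_mod_cast this

end KleinianEta

/-! ### The multiplier system of `η_Δ`. -/

theorem corollary3p10 (Δ : KleinianEta.ADEType) (G : Subgroup SL(2, ℂ)) [Finite G]
    (hG : Δ.IsTypeOf G) (n k : ℕ) (hn : n = Δ.rank) (hk : k = Nat.card G)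
    (χ : CongruenceSubgroup.Gamma0 k → ℂ) :
    KleinianEta.TransformsWith (CongruenceSubgroup.Gamma0 k) ((n : ℝ) / 2) χ Δ.eta ↔
      ∀ (A : CongruenceSubgroup.Gamma0 k) (b c d : ℤ),
        b = (A : SL(2, ℤ)) 0 1 → c = (A : SL(2, ℤ)) 1 0 → d = (A : SL(2, ℤ)) 1 1 →
        (Odd c → χ A = KleinianEta.upperFactor Δ.exponents A *
          KleinianEta.e ((b : ℂ) * d * (((n : ℂ) + 1) * k - 1) / 24)) ∧
        (Even c → χ A = KleinianEta.lowerFactor Δ.exponents A *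
          KleinianEta.e (((b : ℂ) * d * (((n : ℂ) + 1) * k - 1) + 3 * ((d : ℂ) - 1) * n) / 24)) := by
  have hlevel : k = Δ.level := by
    rw [hk, KleinianEta.card_of_isTypeOf G hG]
  have h := KleinianEta.transformsWith_etaProduct_iff (KleinianEta.exponents_zero Δ)
    (hlevel ▸ KleinianEta.dvd_level Δ) (KleinianEta.sum_exponents_div Δ)
    (KleinianEta.sum_exponents_mul Δ) (KleinianEta.sum_exponents_eq_rank Δ) χ
  rw [← hlevel, ← hn] at h
  push_cast at h
  refine h.trans ⟨?_, fun H A => ?_⟩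
  · rintro H A b c d rfl rfl rfl
    rw [H, KleinianEta.etaProductMult]
    refine ⟨fun hc => if_pos hc, fun hc => if_neg (Int.not_odd_iff_even.mpr hc)⟩
  · rw [KleinianEta.etaProductMult]
    split_ifs with hc
    · exact (H A _ _ _ rfl rfl rfl).1 hc
    · exact (H A _ _ _ rfl rfl rfl).2 (Int.not_odd_iff_even.mp hc)
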